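/- Let $n\ge 1$ and let $P$ be a nonnegative real $n\times n$ matrix. Call $P$ reducible if either $n=1$ and $P=0$, or $n\ge 2$ and there are a permutation matrix $Q$ and $1\le r\le n-1$ such that the upper right $r\times(n-r)$ block of $Q^{T}PQ$ is zero; otherwise $P$ is irreducible. Call $P$ primitive if it is irreducible and has only one (complex) eigenvalue of maximum modulus. Write $A>0$ if all entries of the matrix $A$ are positive. For $n\ge 2$ and $1\le k\le n-1$, call $P$ a $g_k^+$-matrix if for every $F$ with $\emptyset\ne F\subsetneq\{1,\dots,n\}$ there is a nonempty $E\subseteq F^{c}$ with $|E|\ge\min(k,|F^{c}|)$ and $\sum_{j\in F}P_{ij}>0$ for all $i\in E$; for $n=1$, call $P$ a $g_1^+$-matrix if $P\neq 0$ (only $k=1$ is considered when $n=1$). **Theorem 4.24.** (Wielandt) $P$ is primitive if and only if $P^{n^2-2n+2}>0$. More generally, if $P$ is a $g_k^+$-matrix (where $k=1$ if $n=1$, and $1\le k\le n-1$ if $n\ge2$), then $P$ is primitive if and only if $P^{h}>0$, where \[ h=\begin{cases}1 & \text{if } n=1,\\ n^2-2n+2 & \text{if } n\ge 2,\ k=1,\\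 \left\lfloor\frac{n-m-3}{k}\right\rfloor+2+(m+1)(n-k+1) & \text{if } n\ge 2,\ k\ge 2,\end{cases} \qquad m=\left\lfloor\frac{n-2}{k}\right\rfloor+1 . \] -/

import Mathlib

namespace GPlus

/-- All entries are nonnegative. -/
def IsNonneg {n : ℕ} (P : Matrix (Fin n) (Fin n) ℝ) : Prop :=
  ∀ i j, 0 ≤ P i j

/-- All entries are positive (written `P > 0`). -/
def IsPos {n : ℕ} (P : Matrix (Fin n) (Fin n) ℝ) : Prop :=
  ∀ i j, 0 < P i j

/-- A square matrix is reducible if it is the `1 × 1` zero matrix, or if it has size `n ≥ 2` and,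
for some permutation matrix `Q` and some `1 ≤ r ≤ n - 1`, the upper right `r × (n - r)` block of
`Qᵀ P Q` is zero. -/
def IsReducible {n : ℕ} (P : Matrix (Fin n) (Fin n) ℝ) : Prop :=
  (n = 1 ∧ P = 0) ∨
  (2 ≤ n ∧ ∃ σ : Equiv.Perm (Fin n), ∃ r : ℕ, 1 ≤ r ∧ r ≤ n - 1 ∧
    ∀ i j : Fin n, i.val < r → r ≤ j.val →
      ((σ.permMatrix ℝ).transpose * P * σ.permMatrix ℝ) i j = 0)

/-- Irreducible: not reducible. -/
def IsIrreducible {n : ℕ} (P : Matrix (Fin n) (Fin n) ℝ) : Prop :=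
  ¬ IsReducible P

/-- `μ` is a complex eigenvalue of the real matrix `P`. -/
def IsEigenvalue {n : ℕ} (P : Matrix (Fin n) (Fin n) ℝ) (μ : ℂ) : Prop :=
  Module.End.HasEigenvalue (Matrix.toLin' (P.map Complex.ofReal)) μ

/-- A nonnegative matrix is primitive if it is irreducible and has only one (complex) eigenvalue
of maximum modulus. -/
def IsPrimitive {n : ℕ} (P : Matrix (Fin n) (Fin n) ℝ) : Prop :=
  IsNonneg P ∧ IsIrreducible P ∧
    ∃! μ : ℂ, IsEigenvalue P μ ∧ ∀ ν : ℂ, IsEigenvalue P ν → ‖ν‖ ≤ ‖μ‖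

/-- `P` is sum-positive on `U × V`, for nonempty `U` and `V`. -/
def IsSumPositiveOn {n : ℕ} (P : Matrix (Fin n) (Fin n) ℝ) (U V : Finset (Fin n)) : Prop :=
  U.Nonempty ∧ V.Nonempty ∧ ∀ i ∈ U, 0 < ∑ j ∈ V, P i j

/-- `P` is a `g_k^+`-matrix. For `n = 1` only `k = 1` is allowed, and the condition is `P ≠ 0`; for
`n ≥ 2` the values `1 ≤ k ≤ n - 1` are allowed. -/
def IsGPlusMatrix {n : ℕ} (k : ℕ) (P : Matrix (Fin n) (Fin n) ℝ) : Prop :=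
  IsNonneg P ∧
  ((n = 1 ∧ k = 1 ∧ P ≠ 0) ∨
   (2 ≤ n ∧ 1 ≤ k ∧ k ≤ n - 1 ∧
    ∀ F : Finset (Fin n), F.Nonempty → F ≠ Finset.univ →
      ∃ E : Finset (Fin n), E.Nonempty ∧ E ⊆ Fᶜ ∧ min k (Fᶜ).card ≤ E.card ∧
        IsSumPositiveOn P E F))

/-- `n² - 2n + 2` for `n ≥ 1`; the order of the terms avoids truncation of the subtraction. -/
def wielandtExponent (n : ℕ) : ℕ := n ^ 2 + 2 - 2 * n

/-- `m = ⌊(n - 2) / k⌋ + 1`, as an integer. -/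
def exponentM (n k : ℕ) : ℤ := ⌊((n : ℚ) - 2) / (k : ℚ)⌋ + 1

/-- `⌊(n - m - 3) / k⌋ + 2 + (m + 1)(n - k + 1)`, as an integer. Note that `n - m - 3` can be
negative. -/
def exponentInt (n k : ℕ) : ℤ :=
  ⌊((n : ℚ) - (exponentM n k : ℚ) - 3) / (k : ℚ)⌋ + 2
    + (exponentM n k + 1) * ((n : ℤ) - (k : ℤ) + 1)

/-- The exponent `h`. -/
def exponentH (n k : ℕ) : ℕ :=
  if n = 1 then 1
  else if k = 1 then wielandtExponent n
  else (exponentInt n k).toNat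

/-- No truncation occurs in `exponentH` in the range where it is used. -/
theorem exponentInt_pos (n k : ℕ) (hk : 2 ≤ k) (hkn : k ≤ n - 1) : 0 < exponentInt n k := by
  have hk0 : (0 : ℚ) < k := by exact_mod_cast (by omega : 0 < k)
  have hkq : (2 : ℚ) ≤ k := by exact_mod_cast hk
  have hnk : (k : ℚ) + 1 ≤ n := by exact_mod_cast (by omega : k + 1 ≤ n)
  have hm1 : 1 ≤ exponentM n k := by
    have : 0 ≤ ⌊((n : ℚ) - 2) / (k : ℚ)⌋ :=
      Int.floor_nonneg.2 (div_nonneg (by linarith) hk0.le)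
    unfold exponentM; omega
  have hmle : (exponentM n k : ℚ) ≤ n - 1 := by
    have h1 : (⌊((n : ℚ) - 2) / (k : ℚ)⌋ : ℚ) ≤ ((n : ℚ) - 2) / k := Int.floor_le _
    have h2 : ((n : ℚ) - 2) / k ≤ n - 2 := div_le_self (by linarith) (by linarith)
    unfold exponentM; push_cast; linarith
  have hf : -1 ≤ ⌊((n : ℚ) - (exponentM n k : ℚ) - 3) / (k : ℚ)⌋ := by
    rw [Int.le_floor, le_div_iff₀ hk0]; push_cast; linarith
  have hz : (0 : ℤ) ≤ (n : ℤ) - (k : ℤ) + 1 := by omega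
  have : 0 ≤ (exponentM n k + 1) * ((n : ℤ) - (k : ℤ) + 1) := mul_nonneg (by omega) hz
  unfold exponentInt; omega

end GPlus

namespace GPlus

/-! An entry of `P ^ t` is positive exactly when the digraph of `P` has a walk of length `t` between
the two indices, so the bound on the exponent is a statement about walks.

Take a closed walk of minimal length `s`; it visits `s` distinct indices. For an index `u` on it,
the set of indices with a walk of length `s * t` to `u` grows strictly with `t` until it is
everything, because some power of `P` is positive. Hence column `u` of `P ^ (s * T)` is positive for
an explicit `T`. By expansion, every index is within `D` steps of the cycle once `n ≤ s + D * k`, so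
`P ^ (s * T + D)` is positive (`isPos_pow_of_minimal_cycle`). Bounding `s` gives the two exponents.

Spectrally, a positive power forces every eigenvalue of maximum modulus to equal its modulus
(`eq_norm_of_isPos_pow`). Conversely, if the closed walks at an index have lengths with gcd `d`, the
spectrum is invariant under rotation by `d`-th roots of unity (`IsEigenvalue.mul_root_of_unity`);
uniqueness forces `d = 1`, and then some power is positive. -/

variable {n : ℕ} {P : Matrix (Fin n) (Fin n) ℝ}

/-! ### Powers as walks -/

theorem IsNonneg.pow (hP : IsNonneg P) (t : ℕ) : IsNonneg (P ^ t) := by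
  induction t with
  | zero =>
    intro i j
    rw [pow_zero, Matrix.one_apply]
    split_ifs <;> norm_num
  | succ t ih =>
    intro i j
    rw [pow_succ, Matrix.mul_apply]
    exact Finset.sum_nonneg fun u _ => mul_nonneg (ih i u) (hP u j)

theorem IsNonneg.pow_add_pos_iff (hP : IsNonneg P) (a b : ℕ) (i j : Fin n) :
    0 < (P ^ (a + b)) i j ↔ ∃ u, 0 < (P ^ a) i u ∧ 0 < (P ^ b) u j := by
  rw [pow_add, Matrix.mul_apply,
    Finset.sum_pos_iff_of_nonneg fun u _ => mul_nonneg (hP.pow a i u) (hP.pow b u j)]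
  constructor
  · rintro ⟨u, -, hu⟩
    refine ⟨u, (hP.pow a i u).lt_of_ne' ?_, (hP.pow b u j).lt_of_ne' ?_⟩
    · exact left_ne_zero_of_mul hu.ne'
    · exact right_ne_zero_of_mul hu.ne'
  · rintro ⟨u, h1, h2⟩
    exact ⟨u, Finset.mem_univ u, mul_pos h1 h2⟩

theorem IsNonneg.pow_add_pos (hP : IsNonneg P) {a b : ℕ} {i u j : Fin n}
    (h1 : 0 < (P ^ a) i u) (h2 : 0 < (P ^ b) u j) : 0 < (P ^ (a + b)) i j :=
  (hP.pow_add_pos_iff a b i j).2 ⟨u, h1, h2⟩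

theorem pow_zero_apply_pos_iff (i j : Fin n) : 0 < (P ^ 0) i j ↔ i = j := by
  rw [pow_zero, Matrix.one_apply]
  split_ifs with h <;> simp [h]

/-! ### Expansion -/

/-- Every nonempty proper set `F` of indices is entered, in the digraph of `P`, from at least
`min k |Fᶜ|` indices outside `F`. -/
def InExpanding (k : ℕ) (P : Matrix (Fin n) (Fin n) ℝ) : Prop :=
  ∀ F : Finset (Fin n), F.Nonempty → F ≠ Finset.univ →
    ∃ E : Finset (Fin n), E ⊆ Fᶜ ∧ min k (Fᶜ).card ≤ E.card ∧ ∀ i ∈ E, ∃ j ∈ F, 0 < P i j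

theorem IsGPlusMatrix.inExpanding {k : ℕ} (hn : 2 ≤ n) (h : IsGPlusMatrix k P) :
    1 ≤ k ∧ k ≤ n - 1 ∧ InExpanding k P := by
  obtain ⟨hP, ⟨h1, -⟩ | ⟨-, hk, hkn, h⟩⟩ := h
  · omega
  refine ⟨hk, hkn, fun F hF hF' => ?_⟩
  obtain ⟨E, -, hEF, hcard, -, -, hE⟩ := h F hF hF'
  refine ⟨E, hEF, hcard, fun i hi => ?_⟩
  have := hE i hi
  rw [Finset.sum_pos_iff_of_nonneg fun j _ => hP i j] at this
  exact this

/-- The indices from which the walks in the digraph of `P` of some length at most `t` lead to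
`j`. -/
noncomputable def inBall (P : Matrix (Fin n) (Fin n) ℝ) (j : Fin n) (t : ℕ) : Finset (Fin n) :=
  open Classical in Finset.univ.filter fun i => ∃ a ≤ t, 0 < (P ^ a) i j

theorem mem_inBall {i j : Fin n} {t : ℕ} : i ∈ inBall P j t ↔ ∃ a ≤ t, 0 < (P ^ a) i j := by
  simp [inBall]

/-- The indices entering a ball from outside lie in the ball of the next radius, so each step adds
at least `k` indices or all the remaining ones. -/
theorem InExpanding.le_card_inBall {k : ℕ} (hP : IsNonneg P) (h : InExpanding k P) (j : Fin n)
    (t : ℕ) : min n (1 + t * k) ≤ (inBall P j t).card := by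
  have hself : ∀ t, j ∈ inBall P j t := fun t =>
    mem_inBall.2 ⟨0, t.zero_le, (pow_zero_apply_pos_iff j j).2 rfl⟩
  induction t with
  | zero =>
    have := Finset.card_pos.2 ⟨j, hself 0⟩
    omega
  | succ t ih =>
    have hsub : inBall P j t ⊆ inBall P j (t + 1) := fun i hi => by
      obtain ⟨a, ha, hi⟩ := mem_inBall.1 hi
      exact mem_inBall.2 ⟨a, by omega, hi⟩
    by_cases hu : inBall P j t = Finset.univ
    · rw [hu] at hsub
      have := Finset.card_le_card hsub
      rw [Finset.card_univ, Fintype.card_fin] at this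
      omega
    obtain ⟨E, hE, hcard, hEF⟩ := h _ ⟨j, hself t⟩ hu
    have hE' : E ⊆ inBall P j (t + 1) := fun i hi => by
      obtain ⟨u, hu, hiu⟩ := hEF i hi
      obtain ⟨a, ha, hua⟩ := mem_inBall.1 hu
      refine mem_inBall.2 ⟨1 + a, by omega, hP.pow_add_pos (u := u) (by simpa using hiu) hua⟩
    have hdisj : Disjoint (inBall P j t) E :=
      Finset.disjoint_left.2 fun x hx hxE => Finset.mem_compl.1 (hE hxE) hx
    have h1 := Finset.card_le_card (Finset.union_subset hsub hE')
    rw [Finset.card_union_of_disjoint hdisj] at h1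
    rw [Finset.card_compl, Fintype.card_fin] at hcard
    have h2 : (t + 1) * k = t * k + k := by ring
    omega

theorem InExpanding.exists_pow_pos {k : ℕ} (hP : IsNonneg P) (h : InExpanding k P) {t : ℕ}
    (ht : n ≤ 1 + t * k) (i j : Fin n) : ∃ a ≤ t, 0 < (P ^ a) i j := by
  have h1 := h.le_card_inBall hP j t
  have h2 : inBall P j t = Finset.univ := by
    rw [← Finset.card_eq_iff_eq_univ, Fintype.card_fin]
    have := Finset.card_le_univ (inBall P j t)
    rw [Fintype.card_fin] at this
    omega
  exact mem_inBall.1 (h2 ▸ Finset.mem_univ i)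

theorem InExpanding.le_card_entries {k : ℕ} (hkn : k ≤ n - 1) (h : InExpanding k P) (hn : 2 ≤ n)
    (j : Fin n) : ∃ E : Finset (Fin n), k ≤ E.card ∧ ∀ i ∈ E, 0 < P i j := by
  obtain ⟨E, -, hcard, hE⟩ := h {j} (Finset.singleton_nonempty j) fun hj => by
    have := congrArg Finset.card hj
    rw [Finset.card_univ, Fintype.card_fin, Finset.card_singleton] at this
    omega
  rw [Finset.card_compl, Fintype.card_fin, Finset.card_singleton] at hcard
  exact ⟨E, by omega, fun i hi => by simpa using hE i hi⟩

theorem InExpanding.exists_row_pos {k : ℕ} (hk : 1 ≤ k) (hn : 2 ≤ n) (h : InExpanding k P)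
    (i : Fin n) : ∃ j, 0 < P i j := by
  have hc : ({i}ᶜ : Finset (Fin n)).card = n - 1 := by
    rw [Finset.card_compl, Fintype.card_fin, Finset.card_singleton]
  obtain ⟨E, hE, hcard, hEF⟩ := h {i}ᶜ (Finset.card_pos.1 (by omega)) fun hj => by
    have := congrArg Finset.card hj
    rw [Finset.card_univ, Fintype.card_fin] at this
    omega
  rw [compl_compl] at hE hcard
  rw [Finset.card_singleton] at hcard
  obtain ⟨x, hx⟩ := Finset.card_pos.1 (by omega : 0 < E.card)
  obtain ⟨j, -, hj⟩ := hEF x hx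
  exact ⟨j, Finset.mem_singleton.1 (hE hx) ▸ hj⟩

/-! ### Shortest closed walks -/

/-- A column of a power that is positive stays positive in all later powers. -/
theorem pow_add_col_pos (hP : IsNonneg P) (hrow : ∀ i, ∃ j, 0 < P i j) {a : ℕ} {v : Fin n}
    (h : ∀ i, 0 < (P ^ a) i v) (e : ℕ) (i : Fin n) : 0 < (P ^ (e + a)) i v := by
  induction e generalizing i with
  | zero => simpa using h i
  | succ e ih =>
    obtain ⟨j, hj⟩ := hrow i
    have := hP.pow_add_pos (a := 1) (by simpa using hj) (ih j)
    rwa [show e + 1 + a = 1 + (e + a) by ring]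

/-- The indices with a walk of length `s * t` to `v`. -/
noncomputable def inPow (P : Matrix (Fin n) (Fin n) ℝ) (v : Fin n) (s t : ℕ) : Finset (Fin n) :=
  open Classical in Finset.univ.filter fun i => 0 < (P ^ (s * t)) i v

theorem mem_inPow {i v : Fin n} {s t : ℕ} : i ∈ inPow P v s t ↔ 0 < (P ^ (s * t)) i v := by
  simp [inPow]

/-- The closed walk at `v` makes these sets increase with `t`. Each set determines the next, so if
two consecutive ones agree the sequence is constant from there on; since a power of `P` is positive,
that constant value is the whole index set. -/
theorem le_card_inPow (hP : IsNonneg P) (hrow : ∀ i, ∃ j, 0 < P i j) {N : ℕ}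
    (hN : IsPos (P ^ N)) {s : ℕ} (hs : 1 ≤ s) {v : Fin n} (hv : 0 < (P ^ s) v v) (t₀ t : ℕ) :
    min n ((inPow P v s t₀).card + t) ≤ (inPow P v s (t₀ + t)).card := by
  have hsub : ∀ t, inPow P v s t ⊆ inPow P v s (t + 1) := fun t i hi =>
    mem_inPow.2 (hP.pow_add_pos (mem_inPow.1 hi) hv)
  induction t with
  | zero => exact min_le_right _ _
  | succ t ih =>
    by_cases heq : inPow P v s (t₀ + t) = inPow P v s (t₀ + t + 1)
    · have hconst : ∀ e, inPow P v s (t₀ + t + e) = inPow P v s (t₀ + t) := by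
        intro e
        induction e with
        | zero => rfl
        | succ e ihe =>
          ext i
          have hadd : s * (t₀ + t + (e + 1)) = s + s * (t₀ + t + e) := by ring
          have hadd' : s * (t₀ + t + 1) = s + s * (t₀ + t) := by ring
          have hmem : ∀ u, 0 < (P ^ (s * (t₀ + t + e))) u v ↔ 0 < (P ^ (s * (t₀ + t))) u v :=
            fun u => by rw [← mem_inPow, ihe, mem_inPow]
          rw [heq, mem_inPow, mem_inPow, hadd, hadd', hP.pow_add_pos_iff, hP.pow_add_pos_iff]
          simp only [hmem]
      have huniv : inPow P v s (t₀ + t + N) = Finset.univ := by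
        refine Finset.eq_univ_of_forall fun i => mem_inPow.2 ?_
        have hle : N ≤ s * (t₀ + t + N) := by nlinarith
        obtain ⟨e, he⟩ := Nat.exists_eq_add_of_le' hle
        rw [he]
        exact pow_add_col_pos hP hrow (fun i => hN i v) e i
      rw [hconst, heq] at huniv
      rw [← add_assoc t₀ t 1, huniv, Finset.card_univ, Fintype.card_fin]
      exact min_le_left _ _
    · have := Finset.card_lt_card ((hsub (t₀ + t)).ssubset_of_ne heq)
      rw [← add_assoc t₀ t 1]
      omega

/-- The vertices on a closed walk of minimal length `s` are `s` distinct indices, each of them on a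
closed walk of length `s`. -/
theorem exists_minimal_cycle (hP : IsNonneg P) {s : ℕ} {v : Fin n} (hv : 0 < (P ^ s) v v)
    (hmin : ∀ r, 1 ≤ r → r < s → ∀ u, ¬ 0 < (P ^ r) u u) :
    ∃ C : Finset (Fin n), C.card = s ∧ ∀ u ∈ C, 0 < (P ^ s) u u := by
  have hwalk : ∀ t : Fin s, ∃ u, 0 < (P ^ (t : ℕ)) v u ∧ 0 < (P ^ (s - t)) u v := fun t => by
    rw [← hP.pow_add_pos_iff, Nat.add_sub_cancel' t.2.le]
    exact hv
  choose u hu hu' using hwalk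
  -- A repeated index would allow the part of the walk between its two visits to be cut out, leaving
  -- a shorter closed walk.
  have hne : ∀ a b : Fin s, a < b → u a ≠ u b := fun a b hab heq => by
    have h1 : 0 < (P ^ (s - b)) (u a) v := heq ▸ hu' b
    have hab' : (a : ℕ) < b := hab
    exact hmin (a + (s - b)) (by omega) (by omega) v (hP.pow_add_pos (hu a) h1)
  have hinj : Function.Injective u := fun a b hab => by
    rcases lt_trichotomy a b with h | h | h
    · exact (hne a b h hab).elim
    · exact h
    · exact (hne b a h hab.symm).elim
  refine ⟨Finset.univ.image u, ?_, ?_⟩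
  · rw [Finset.card_image_of_injective _ hinj, Finset.card_univ, Fintype.card_fin]
  · intro x hx
    obtain ⟨t, -, rfl⟩ := Finset.mem_image.1 hx
    have := hP.pow_add_pos (hu' t) (hu t)
    rwa [Nat.sub_add_cancel t.2.le] at this

/-- The `s` indices of the cycle and the ball of radius `D` around `j` have together more than `n`
elements, so they share some `u`. A walk to `u` of length `s * T`, lengthened at its start by the
unused steps of `D`, is then continued to `j`. -/
theorem isPos_pow_of_minimal_cycle {k : ℕ} (hP : IsNonneg P) (hG : InExpanding k P)
    (hrow : ∀ i, ∃ j, 0 < P i j) {s T D : ℕ} {v : Fin n} (hv : 0 < (P ^ s) v v)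
    (hmin : ∀ r, 1 ≤ r → r < s → ∀ u, ¬ 0 < (P ^ r) u u)
    (hT : ∀ u, 0 < (P ^ s) u u → ∀ i, 0 < (P ^ (s * T)) i u) (hs : 1 ≤ s)
    (hD : n ≤ s + D * k) :
    IsPos (P ^ (s * T + D)) := by
  intro i j
  obtain ⟨C, hC, hCs⟩ := exists_minimal_cycle hP hv hmin
  have hball := hG.le_card_inBall hP j D
  have : ∃ u ∈ C, u ∈ inBall P j D := by
    by_contra! hno
    have hdisj : Disjoint C (inBall P j D) := Finset.disjoint_left.2 hno
    have h1 := Finset.card_le_univ (C ∪ inBall P j D)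
    rw [Finset.card_union_of_disjoint hdisj, Fintype.card_fin, hC] at h1
    omega
  obtain ⟨u, hu, hub⟩ := this
  obtain ⟨a, ha, hua⟩ := mem_inBall.1 hub
  have h1 := pow_add_col_pos hP hrow (hT u (hCs u hu)) (D - a) i
  have h2 := hP.pow_add_pos h1 hua
  rwa [show D - a + s * T + a = s * T + D by omega] at h2

theorem exists_minimal_closed_walk (h : ∃ r, 1 ≤ r ∧ ∃ u, 0 < (P ^ r) u u) :
    ∃ s, 1 ≤ s ∧ (∃ v, 0 < (P ^ s) v v) ∧ ∀ r, 1 ≤ r → ∀ u, 0 < (P ^ r) u u → s ≤ r := by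
  classical
  refine ⟨Nat.find h, (Nat.find_spec h).1, (Nat.find_spec h).2, fun r hr u hu => ?_⟩
  exact Nat.find_min' h ⟨hr, u, hu⟩

/-- If each row of `P` has at most one positive entry, so do its powers. -/
theorem pow_row_subsingleton (hP : IsNonneg P)
    (h : ∀ i a b, 0 < P i a → 0 < P i b → a = b) (t : ℕ) (i a b : Fin n)
    (ha : 0 < (P ^ t) i a) (hb : 0 < (P ^ t) i b) : a = b := by
  induction t generalizing a b with
  | zero =>
    rw [pow_zero_apply_pos_iff] at ha hb
    exact ha.symm.trans hb
  | succ t ih =>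
    obtain ⟨u, hu, hua⟩ := (hP.pow_add_pos_iff t 1 i a).1 ha
    obtain ⟨w, hw, hwb⟩ := (hP.pow_add_pos_iff t 1 i b).1 hb
    rw [pow_one] at hua hwb
    exact h u a b hua (ih u w hu hw ▸ hwb)

/-- A matrix of size at least two with a positive power has a closed walk of length less than its
size. -/
theorem exists_short_closed_walk (hn : 2 ≤ n) (hP : IsNonneg P) (hG : InExpanding 1 P) {N : ℕ}
    (hN : IsPos (P ^ N)) : ∃ r, 1 ≤ r ∧ r ≤ n - 1 ∧ ∃ u, 0 < (P ^ r) u u := by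
  -- Otherwise every row of `P ^ N` would have at most one positive entry.
  have hex : ∃ i a b, 0 < P i a ∧ 0 < P i b ∧ a ≠ b := by
    by_contra! hno
    have := pow_row_subsingleton hP hno N ⟨0, by omega⟩ ⟨0, by omega⟩ ⟨1, by omega⟩
      (hN _ _) (hN _ _)
    simp at this
  obtain ⟨i, a, b, ha, hb, hab⟩ := hex
  -- This ball has at least `n - 1` elements, so it cannot miss both successors `a` and `b` of `i`.
  have hball := hG.le_card_inBall hP i (n - 2)
  have : ∃ x, 0 < P i x ∧ x ∈ inBall P i (n - 2) := by
    by_contra! hno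
    have hdisj : Disjoint {a, b} (inBall P i (n - 2)) := by
      rw [Finset.disjoint_left]
      intro x hx
      rcases Finset.mem_insert.1 hx with rfl | hx
      · exact hno _ ha
      · rw [Finset.mem_singleton.1 hx]
        exact hno _ hb
    have h1 := Finset.card_le_univ ({a, b} ∪ inBall P i (n - 2))
    rw [Finset.card_union_of_disjoint hdisj, Fintype.card_fin, Finset.card_pair hab] at h1
    omega
  obtain ⟨x, hx, hxb⟩ := this
  obtain ⟨c, hc, hxc⟩ := mem_inBall.1 hxb
  exact ⟨1 + c, by omega, by omega, i, hP.pow_add_pos (by simpa using hx) hxc⟩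

theorem exists_closed_walk {k : ℕ} (hP : IsNonneg P) (hG : InExpanding k P)
    (hrow : ∀ i, ∃ j, 0 < P i j) {t : ℕ} (ht : n ≤ 1 + t * k) (v : Fin n) :
    ∃ r, 1 ≤ r ∧ r ≤ t + 1 ∧ 0 < (P ^ r) v v := by
  obtain ⟨j, hj⟩ := hrow v
  obtain ⟨a, ha, hja⟩ := hG.exists_pow_pos hP ht j v
  exact ⟨1 + a, by omega, by omega, hP.pow_add_pos (by simpa using hj) hja⟩

/-! ### The two exponents -/

theorem isPos_pow_wielandtExponent (hn : 2 ≤ n) (hP : IsNonneg P) (hG : InExpanding 1 P) {N : ℕ}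
    (hN : IsPos (P ^ N)) : IsPos (P ^ wielandtExponent n) := by
  have hrow := hG.exists_row_pos le_rfl hn
  obtain ⟨r, hr, hrn, u, hu⟩ := exists_short_closed_walk hn hP hG hN
  obtain ⟨s, hs, ⟨v, hv⟩, hmin⟩ := exists_minimal_closed_walk ⟨r, hr, u, hu⟩
  have hsn : s ≤ n - 1 := (hmin r hr u hu).trans hrn
  -- The exponent is `(n - 1) ^ 2 + 1`; with `e = n - 1 - s`, what remains after `s * (n - 1)` is `e
  -- * (n - 1) + 1`.
  obtain ⟨D, hD⟩ : ∃ D, wielandtExponent n = s * (n - 1) + D ∧ n ≤ s + D * 1 := by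
    obtain ⟨c, rfl⟩ := Nat.exists_eq_add_of_le' hn
    obtain ⟨e, he⟩ := Nat.exists_eq_add_of_le hsn
    have h1 : c + 1 = s + e := by omega
    refine ⟨e * (c + 1) + 1, ?_, ?_⟩
    · have h2 : (c + 2) ^ 2 + 2 = (s + e) * (c + 1) + 1 + 2 * (c + 2) := by rw [← h1]; ring
      have h3 : (s + e) * (c + 1) = s * (c + 1) + e * (c + 1) := by ring
      rw [wielandtExponent, show c + 2 - 1 = c + 1 by omega]
      omega
    · nlinarith [Nat.zero_le (e * c)]
  rw [hD.1]
  refine isPos_pow_of_minimal_cycle hP hG hrow hv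
    (fun r hr hrs u hu => absurd (hmin r hr u hu) (by omega)) (fun u hu i => ?_) hs hD.2
  have h1 := le_card_inPow hP hrow hN hs hu 0 (n - 1)
  have h2 : 0 < (inPow P u s 0).card :=
    Finset.card_pos.2 ⟨u, mem_inPow.2 ((pow_zero_apply_pos_iff u u).2 rfl)⟩
  have h3 : inPow P u s (n - 1) = Finset.univ := by
    rw [← Finset.card_eq_iff_eq_univ, Fintype.card_fin]
    have := Finset.card_le_univ (inPow P u s (n - 1))
    rw [Fintype.card_fin] at this
    rw [zero_add] at h1
    omega
  exact mem_inPow.1 (h3 ▸ Finset.mem_univ i)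

theorem exponentM_eq {k : ℕ} (hn : 2 ≤ n) : exponentM n k = (((n - 2) / k + 1 : ℕ) : ℤ) := by
  have : ((n : ℚ) - 2) / k = ((n - 2 : ℕ) : ℚ) / (k : ℚ) := by
    rw [Nat.cast_sub hn]
    norm_num
  rw [exponentM, this, Rat.floor_natCast_div_natCast]
  push_cast
  rfl

theorem isPos_pow_exponentInt {k : ℕ} (hk : 2 ≤ k) (hkn : k ≤ n - 1) (hP : IsNonneg P)
    (hG : InExpanding k P) {N : ℕ} (hN : IsPos (P ^ N)) : IsPos (P ^ (exponentInt n k).toNat) := by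
  have hn : 2 ≤ n := by omega
  have hrow := hG.exists_row_pos (by omega) hn
  set m := (n - 2) / k + 1 with hm
  -- Here `m` is `(n - 1) / k` rounded up, a radius at which every ball is everything.
  have hmk : n ≤ 1 + m * k := by
    have h1 := Nat.lt_div_mul_add (a := n - 2) (by omega : 0 < k)
    have h2 : m * k = (n - 2) / k * k + k := by rw [hm]; ring
    omega
  have hmn : m ≤ n - 1 := by
    have := Nat.div_le_self (n - 2) k
    omega
  obtain ⟨r, hr, hrm, hr'⟩ := exists_closed_walk hP hG hrow hmk ⟨0, by omega⟩
  obtain ⟨s, hs, ⟨v, hv⟩, hmin⟩ := exists_minimal_closed_walk ⟨r, hr, _, hr'⟩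
  have hsm : s ≤ m + 1 := (hmin r hr _ hr').trans hrm
  -- Since `q` may be `-1`, the natural number used is `p = q + 1`; the term with `e = m + 1 - s`
  -- makes up for a cycle shorter than the bound.
  obtain ⟨D, hD⟩ : ∃ D, (exponentInt n k).toNat = s * (n - k + 1) + D ∧ n ≤ s + D * k := by
    set q : ℤ := ⌊((n : ℚ) - (exponentM n k : ℚ) - 3) / (k : ℚ)⌋ with hq
    have hk0 : (0 : ℚ) < k := by exact_mod_cast (by omega : 0 < k)
    have hlt : (n : ℤ) - m - 3 < (q + 1) * k := by
      have h1 := Int.lt_floor_add_one (((n : ℚ) - (exponentM n k : ℚ) - 3) / (k : ℚ))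
      rw [← hq, div_lt_iff₀ hk0, exponentM_eq hn, ← hm] at h1
      exact_mod_cast h1
    have hq1 : -1 ≤ q := by
      by_contra! hlt'
      have : (q + 1) * k ≤ -1 * k := by
        apply mul_le_mul_of_nonneg_right <;> omega
      omega
    obtain ⟨e, he⟩ := Nat.exists_eq_add_of_le hsm
    obtain ⟨p, hp⟩ := Int.eq_ofNat_of_zero_le (by omega : 0 ≤ q + 1)
    refine ⟨p + 1 + e * (n - k + 1), ?_, ?_⟩
    · have : exponentInt n k = ((s * (n - k + 1) + (p + 1 + e * (n - k + 1)) : ℕ) : ℤ) := by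
        rw [exponentInt, ← hq, exponentM_eq hn, ← hm]
        have h2 : ((m : ℤ) + 1) = s + e := by exact_mod_cast he
        rw [h2]
        push_cast [Nat.cast_sub (by omega : k ≤ n)]
        linear_combination hp
      rw [this, Int.toNat_natCast]
    · rw [hp] at hlt
      have h3 : n < m + 3 + p * k := by
        zify
        have : (n : ℤ) - m - 3 < p * k := by exact_mod_cast hlt
        linarith
      have h4 : (p + 1 + e * (n - k + 1)) * k = p * k + k + e * ((n - k + 1) * k) := by ring
      have h5 : e ≤ e * ((n - k + 1) * k) := Nat.le_mul_of_pos_right e (by positivity)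
      omega
  rw [hD.1]
  refine isPos_pow_of_minimal_cycle hP hG hrow hv
    (fun r hr hrs u hu => absurd (hmin r hr u hu) (by omega)) (fun u hu i => ?_) hs hD.2
  have h1 := le_card_inPow hP hrow hN hs hu 1 (n - k)
  -- The successor `w` of `u` on a closed walk has at least `k` predecessors, and each reaches `u`
  -- in `s` steps. Growth thus starts from `k` indices at `t = 1`, whence `T = n - k + 1`.
  have h2 : k ≤ (inPow P u s 1).card := by
    obtain ⟨w, -, hw⟩ := (hP.pow_add_pos_iff 1 (s - 1) u u).1 (by rwa [Nat.add_sub_cancel' hs])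
    obtain ⟨E, hE, hEw⟩ := hG.le_card_entries hkn hn w
    refine hE.trans (Finset.card_le_card fun x hx => mem_inPow.2 ?_)
    have := hP.pow_add_pos (a := 1) (by simpa using hEw x hx) hw
    rwa [Nat.add_sub_cancel' hs, ← mul_one s] at this
  have h3 : inPow P u s (n - k + 1) = Finset.univ := by
    rw [← Finset.card_eq_iff_eq_univ, Fintype.card_fin]
    have := Finset.card_le_univ (inPow P u s (n - k + 1))
    rw [Fintype.card_fin] at this
    rw [add_comm 1] at h1
    omega
  exact mem_inPow.1 (h3 ▸ Finset.mem_univ i)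

/-! ### Eigenvalues of maximum modulus -/

theorem isEigenvalue_iff_mem_spectrum {μ : ℂ} :
    IsEigenvalue P μ ↔ μ ∈ spectrum ℂ (P.map Complex.ofReal) := by
  rw [IsEigenvalue, Module.End.hasEigenvalue_iff_mem_spectrum, Matrix.spectrum_toLin']

theorem isEigenvalue_iff_exists {μ : ℂ} :
    IsEigenvalue P μ ↔ ∃ x : Fin n → ℂ, x ≠ 0 ∧ ∀ i, ∑ j, (P i j : ℂ) * x j = μ * x i := by
  have key : ∀ x : Fin n → ℂ, Matrix.toLin' (P.map Complex.ofReal) x = μ • x ↔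
      ∀ i, ∑ j, (P i j : ℂ) * x j = μ * x i := fun x => by
    rw [Matrix.toLin'_apply, funext_iff]
    rfl
  constructor
  · intro h
    obtain ⟨x, hx⟩ := h.exists_hasEigenvector
    exact ⟨x, hx.2, (key x).1 hx.apply_eq_smul⟩
  · rintro ⟨x, hx0, hx⟩
    exact Module.End.hasEigenvalue_of_hasEigenvector
      (Module.End.hasEigenvector_iff.2 ⟨Module.End.mem_eigenspace_iff.2 ((key x).2 hx), hx0⟩)

theorem map_ofReal_pow (t : ℕ) : (P ^ t).map Complex.ofReal = P.map Complex.ofReal ^ t :=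
  map_pow Complex.ofRealHom.mapMatrix P t

theorem isEigenvalue_pow_iff {t : ℕ} (ht : 0 < t) {μ : ℂ} :
    IsEigenvalue (P ^ t) μ ↔ ∃ ν, IsEigenvalue P ν ∧ ν ^ t = μ := by
  simp only [isEigenvalue_iff_mem_spectrum]
  rw [map_ofReal_pow, spectrum.map_pow_of_pos _ ht]
  rfl

theorem exists_isEigenvalue_max (hn : 1 ≤ n) (P : Matrix (Fin n) (Fin n) ℝ) :
    ∃ μ, IsEigenvalue P μ ∧ ∀ ν, IsEigenvalue P ν → ‖ν‖ ≤ ‖μ‖ := by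
  have : Nonempty (Fin n) := ⟨⟨0, hn⟩⟩
  have hfin : (spectrum ℂ (P.map Complex.ofReal)).Finite := Matrix.finite_spectrum _
  obtain ⟨μ, hμ, hmax⟩ := hfin.exists_maximalFor (fun z => ‖z‖) _
    (spectrum.nonempty_of_isAlgClosed_of_finiteDimensional ℂ _)
  refine ⟨μ, isEigenvalue_iff_mem_spectrum.2 hμ, fun ν hν => ?_⟩
  exact (le_total ‖ν‖ ‖μ‖).elim id fun h => hmax (isEigenvalue_iff_mem_spectrum.1 hν) h

theorem IsNonneg.mul_le_pow_mulVec (hP : IsNonneg P) {y : Fin n → ℝ} {r : ℝ} (hr : 0 ≤ r)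
    (h : ∀ i, r * y i ≤ (P.mulVec y) i) (t : ℕ) (i : Fin n) :
    r ^ t * y i ≤ ((P ^ t).mulVec y) i := by
  induction t generalizing i with
  | zero => simp
  | succ t ih =>
    calc r ^ (t + 1) * y i = r ^ t * (r * y i) := by ring
      _ ≤ r ^ t * (P.mulVec y) i := mul_le_mul_of_nonneg_left (h i) (pow_nonneg hr t)
      _ = ∑ j, P i j * (r ^ t * y j) := by
        rw [Matrix.mulVec, dotProduct, Finset.mul_sum]
        exact Finset.sum_congr rfl fun j _ => by ring
      _ ≤ ∑ j, P i j * ((P ^ t).mulVec y) j :=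
        Finset.sum_le_sum fun j _ => mul_le_mul_of_nonneg_left (ih j) (hP i j)
      _ = ((P ^ (t + 1)).mulVec y) i := by
        rw [pow_succ', ← Matrix.mulVec_mulVec]
        rfl

attribute [local instance] Matrix.linftyOpNormedRing Matrix.linftyOpNormedAlgebra in
/-- A nonnegative matrix that stretches some nonzero nonnegative vector by at least `r` has an
eigenvalue of modulus at least `r`. -/
theorem IsNonneg.exists_isEigenvalue_ge (hP : IsNonneg P) {y : Fin n → ℝ} (hy : 0 ≤ y)
    (hy0 : y ≠ 0) {r : ℝ} (hr : 0 ≤ r) (h : ∀ i, r * y i ≤ (P.mulVec y) i) :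
    ∃ μ, IsEigenvalue P μ ∧ r ≤ ‖μ‖ := by
  obtain ⟨i₀, hi₀⟩ := Function.ne_iff.1 hy0
  have : Nonempty (Fin n) := ⟨i₀⟩
  set M : Matrix (Fin n) (Fin n) ℂ := P.map Complex.ofReal with hM
  have hcomplete : CompleteSpace (Matrix (Fin n) (Fin n) ℂ) := FiniteDimensional.complete ℂ _
  have hynorm : 0 < ‖y‖ := norm_pos_iff.2 hy0
  -- Iterating the stretching bounds the norms of the powers below; Gelfand's formula then bounds
  -- the spectral radius.
  have hpow : ∀ t, r ^ t ≤ ‖M ^ t‖ := by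
    intro t
    have h1 : ∀ i, ‖r ^ t * y i‖ ≤ ‖M ^ t‖ * ‖y‖ := fun i => by
      rw [Real.norm_of_nonneg (mul_nonneg (pow_nonneg hr t) (hy i))]
      refine (hP.mul_le_pow_mulVec hr h t i).trans ?_
      have h2 : (((P ^ t).mulVec y i : ℝ) : ℂ) = (M ^ t).mulVec (fun j => (y j : ℂ)) i := by
        rw [hM, ← map_ofReal_pow]
        simp [Matrix.mulVec, dotProduct]
      have h3 : ‖fun j => (y j : ℂ)‖ ≤ ‖y‖ :=
        (pi_norm_le_iff_of_nonneg (norm_nonneg y)).2 fun j => by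
          rw [Complex.norm_real]
          exact norm_le_pi_norm y j
      calc (P ^ t).mulVec y i ≤ ‖(((P ^ t).mulVec y i : ℝ) : ℂ)‖ := by
            rw [Complex.norm_real]
            exact Real.le_norm_self _
        _ ≤ ‖(M ^ t).mulVec (fun j => (y j : ℂ))‖ := by
            rw [h2]
            exact norm_le_pi_norm _ i
        _ ≤ ‖M ^ t‖ * ‖fun j => (y j : ℂ)‖ := Matrix.linfty_opNorm_mulVec _ _
        _ ≤ ‖M ^ t‖ * ‖y‖ := mul_le_mul_of_nonneg_left h3 (norm_nonneg _)
    have h4 : ‖r ^ t • y‖ ≤ ‖M ^ t‖ * ‖y‖ :=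
      (pi_norm_le_iff_of_nonneg (by positivity)).2 h1
    rw [norm_smul, Real.norm_of_nonneg (pow_nonneg hr t)] at h4
    exact le_of_mul_le_mul_right h4 hynorm
  obtain ⟨μ, hμ, hμr⟩ := spectrum.exists_nnnorm_eq_spectralRadius M
  refine ⟨μ, isEigenvalue_iff_mem_spectrum.2 hμ, ?_⟩
  have hlim := spectrum.pow_norm_pow_one_div_tendsto_nhds_spectralRadius M
  have hge : ENNReal.ofReal r ≤ spectralRadius ℂ M := by
    refine ge_of_tendsto hlim (Filter.eventually_atTop.2 ⟨1, fun t ht => ?_⟩)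
    refine ENNReal.ofReal_le_ofReal ?_
    have ht0 : t ≠ 0 := by omega
    calc r = (r ^ t) ^ (1 / t : ℝ) := by
          rw [one_div, Real.pow_rpow_inv_natCast hr ht0]
      _ ≤ ‖M ^ t‖ ^ (1 / t : ℝ) := Real.rpow_le_rpow (pow_nonneg hr t) (hpow t) (by positivity)
  rw [← hμr, ENNReal.ofReal, ENNReal.coe_le_coe] at hge
  exact Real.toNNReal_le_iff_le_coe.1 hge

/-- Equality in the weighted triangle inequality forces a common phase. -/
theorem exists_phase_of_norm_sum_eq {ι : Type*} [Fintype ι] {a : ι → ℝ} (ha : ∀ j, 0 < a j)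
    {x : ι → ℂ} (h : ‖∑ j, (a j : ℂ) * x j‖ = ∑ j, a j * ‖x j‖) :
    ∃ c : ℂ, c ≠ 0 ∧ ∀ j, x j = c * (‖x j‖ : ℂ) := by
  obtain ⟨c, hc, hcS⟩ := Complex.exists_norm_mul_eq_self (∑ j, (a j : ℂ) * x j)
  have hc0 : c ≠ 0 := norm_pos_iff.1 (by rw [hc]; exact one_pos)
  have hconj : (starRingEnd ℂ) c * c = 1 := by
    rw [← Complex.normSq_eq_conj_mul_self, Complex.normSq_eq_norm_sq, hc]
    norm_num
  refine ⟨c, hc0, ?_⟩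
  have hre : ∀ j, ((starRingEnd ℂ) c * x j).re ≤ ‖x j‖ := fun j => by
    refine (Complex.re_le_norm _).trans ?_
    rw [norm_mul, RCLike.norm_conj, hc, one_mul]
  -- After rotation by the conjugate phase the sum is real. The real parts are at most the moduli
  -- and have the same weighted total, so they agree term by term.
  have hsum : ∑ j, a j * ((starRingEnd ℂ) c * x j).re = ∑ j, a j * ‖x j‖ := by
    have h1 : (starRingEnd ℂ) c * ∑ j, (a j : ℂ) * x j = (∑ j, a j * ‖x j‖ : ℝ) := by
      rw [← hcS, ← mul_assoc, hconj, one_mul, h]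
    rw [← Complex.ofReal_re (∑ j, a j * ‖x j‖), ← h1, Finset.mul_sum, Complex.re_sum]
    refine Finset.sum_congr rfl fun j _ => ?_
    rw [mul_left_comm, Complex.re_ofReal_mul]
  rw [Finset.sum_eq_sum_iff_of_le fun j _ => mul_le_mul_of_nonneg_left (hre j) (ha j).le] at hsum
  intro j
  have h1 : ((starRingEnd ℂ) c * x j).re = ‖(starRingEnd ℂ) c * x j‖ := by
    rw [norm_mul, RCLike.norm_conj, hc, one_mul]
    exact mul_left_cancel₀ (ha j).ne' (hsum j (Finset.mem_univ j))
  have h2 : (starRingEnd ℂ) c * x j = (‖x j‖ : ℂ) := by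
    have h3 := Complex.re_eq_norm.1 h1
    have h4 := Complex.eq_re_of_ofReal_le h3
    rw [h4, h1, norm_mul, RCLike.norm_conj, hc, one_mul]
  rw [← h2, ← mul_assoc, mul_comm c, hconj, one_mul]

theorem IsPos.mulVec_pos {A : Matrix (Fin n) (Fin n) ℝ} (hA : IsPos A) {y : Fin n → ℝ}
    (hy : ∀ i, 0 ≤ y i) {i₀ : Fin n} (hi₀ : 0 < y i₀) (i : Fin n) : 0 < A.mulVec y i :=
  Finset.sum_pos' (fun j _ => mul_nonneg (hA i j).le (hy j))
    ⟨i₀, Finset.mem_univ _, mul_pos (hA i i₀) hi₀⟩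

/-- A nonnegative vector that a positive matrix stretches by at least the largest modulus of an
eigenvalue is an eigenvector. -/
theorem IsPos.mulVec_eq_of_le {A : Matrix (Fin n) (Fin n) ℝ} (hA : IsPos A) {z : Fin n → ℝ}
    (hz : ∀ i, 0 ≤ z i) {ρ : ℝ} (hρ : 0 ≤ ρ) (hmax : ∀ ν, IsEigenvalue A ν → ‖ν‖ ≤ ρ)
    (hle : ∀ i, ρ * z i ≤ A.mulVec z i) (i : Fin n) : A.mulVec z i = ρ * z i := by
  by_contra hne
  have hlt : ρ * z i < A.mulVec z i := (hle i).lt_of_ne' hne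
  have hzpos : ∃ i₀, 0 < z i₀ := by
    by_contra! hno
    have h0 : z = 0 := funext fun j => le_antisymm (hno j) (hz j)
    simp [h0] at hne
  obtain ⟨i₀, hi₀⟩ := hzpos
  set y := A.mulVec z with hy
  have hypos : ∀ j, 0 < y j := hA.mulVec_pos hz hi₀
  -- Applying `A` to the nonzero nonnegative vector `y - ρ • z` makes every inequality strict, so
  -- the least ratio over the indices is a stretching factor exceeding `ρ`.
  have hAy : ∀ j, ρ * y j < A.mulVec y j := fun j => by
    have h1 := hA.mulVec_pos (y := y - ρ • z) (fun j => sub_nonneg.2 (hle j)) (sub_pos.2 hlt) j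
    rw [Matrix.mulVec_sub, Matrix.mulVec_smul, ← hy] at h1
    exact sub_pos.1 h1
  obtain ⟨i₁, -, hi₁⟩ := Finset.exists_min_image Finset.univ (fun j => A.mulVec y j / y j)
    ⟨i, Finset.mem_univ i⟩
  have hr : ρ < A.mulVec y i₁ / y i₁ := (lt_div_iff₀ (hypos i₁)).2 (hAy i₁)
  obtain ⟨ν, hν, hge⟩ := IsNonneg.exists_isEigenvalue_ge (fun i j => (hA i j).le)
    (fun j => (hypos j).le) (fun h0 => (hypos i).ne' (congrFun h0 i)) (hρ.trans hr.le)
    fun j => (le_div_iff₀ (hypos j)).1 (hi₁ j (Finset.mem_univ j))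
  exact absurd (hmax ν hν) (by linarith)

/-- For an eigenvector `x`, the triangle inequality shows that `P ^ N` stretches the vector of
moduli by at least `‖μ‖ ^ N`, so equality holds. The entries of `x` then share a phase; removing it
leaves a nonnegative eigenvector of `P` for `μ`. -/
theorem eq_norm_of_isPos_pow (hP : IsNonneg P) {N : ℕ} (hN : 1 ≤ N) (hA : IsPos (P ^ N)) {μ : ℂ}
    (hμ : IsEigenvalue P μ) (hmax : ∀ ν, IsEigenvalue P ν → ‖ν‖ ≤ ‖μ‖) : μ = ‖μ‖ := by
  obtain ⟨x, hx0, hx⟩ := isEigenvalue_iff_exists.1 hμ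
  have hxN : ∀ t i, ∑ j, ((P ^ t) i j : ℂ) * x j = μ ^ t * x i := by
    have hstep : (P.map Complex.ofReal).mulVec x = μ • x := funext hx
    intro t
    have : ((P ^ t).map Complex.ofReal).mulVec x = μ ^ t • x := by
      rw [map_ofReal_pow]
      induction t with
      | zero => simp
      | succ t ih =>
        rw [pow_succ, ← Matrix.mulVec_mulVec, hstep, Matrix.mulVec_smul, ih, smul_smul, pow_succ']
    exact congrFun this
  have hnorm : ∀ i, ‖∑ j, ((P ^ N) i j : ℂ) * x j‖ = ‖μ‖ ^ N * ‖x i‖ := fun i => by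
    rw [hxN, norm_mul, norm_pow]
  have heq := hA.mulVec_eq_of_le (z := fun j => ‖x j‖) (fun j => norm_nonneg _)
    (ρ := ‖μ‖ ^ N) (by positivity)
    (fun ν hν => by
      obtain ⟨ν', hν', rfl⟩ := (isEigenvalue_pow_iff (by omega)).1 hν
      rw [norm_pow]
      exact pow_le_pow_left₀ (norm_nonneg _) (hmax ν' hν') N)
    (fun i => by
      rw [← hnorm]
      refine (norm_sum_le _ _).trans_eq (Finset.sum_congr rfl fun j _ => ?_)
      rw [norm_mul, Complex.norm_real, Real.norm_of_nonneg (hA i j).le])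
  obtain ⟨i, hi⟩ := Function.ne_iff.1 hx0
  obtain ⟨c, hc, hcx⟩ := exists_phase_of_norm_sum_eq (hA i) ((hnorm i).trans (heq i).symm)
  have hPi : ((∑ j, P i j * ‖x j‖ : ℝ) : ℂ) = μ * (‖x i‖ : ℂ) := by
    refine mul_left_cancel₀ hc ?_
    rw [mul_left_comm, ← hcx, ← hx, Complex.ofReal_sum, Finset.mul_sum]
    refine Finset.sum_congr rfl fun j _ => ?_
    rw [Complex.ofReal_mul, mul_left_comm, ← hcx]
  have hxi : 0 < ‖x i‖ := norm_pos_iff.2 hi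
  have hμ' : μ = ((∑ j, P i j * ‖x j‖) / ‖x i‖ : ℝ) := by
    rw [Complex.ofReal_div, hPi, mul_div_cancel_right₀ _ (Complex.ofReal_ne_zero.2 hxi.ne')]
  have hnn : 0 ≤ (∑ j, P i j * ‖x j‖) / ‖x i‖ :=
    div_nonneg (Finset.sum_nonneg fun j _ => mul_nonneg (hP i j) (norm_nonneg _)) hxi.le
  rw [hμ', Complex.norm_real, Real.norm_of_nonneg hnn]

/-! ### Reducibility as a closed set of indices -/

theorem permMatrix_conj_apply (σ : Equiv.Perm (Fin n)) (i j : Fin n) :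
    ((σ.permMatrix ℝ).transpose * P * σ.permMatrix ℝ) i j = P (σ.symm i) (σ.symm j) := by
  rw [Matrix.transpose_permMatrix, Equiv.Perm.permMatrix, Equiv.Perm.permMatrix,
    PEquiv.toMatrix_toPEquiv_mul, PEquiv.mul_toMatrix_toPEquiv]
  rfl

theorem isReducible_iff_exists_finset (hn : 2 ≤ n) :
    IsReducible P ↔ ∃ S : Finset (Fin n), S.Nonempty ∧ S ≠ Finset.univ ∧
      ∀ i ∈ S, ∀ j ∉ S, P i j = 0 := by
  constructor
  · rintro (⟨h1, -⟩ | ⟨-, σ, r, hr, hrn, h⟩)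
    · omega
    refine ⟨Finset.univ.filter fun i => (σ i).val < r, ⟨σ.symm ⟨0, by omega⟩, ?_⟩, ?_, ?_⟩
    · simpa using (by omega : 0 < r)
    · intro hu
      have := hu ▸ Finset.mem_univ (σ.symm ⟨r, by omega⟩)
      simp at this
    · intro i hi j hj
      have := h (σ i) (σ j) (by simpa using hi) (by simpa using hj)
      rwa [permMatrix_conj_apply, σ.symm_apply_apply, σ.symm_apply_apply] at this
  · rintro ⟨S, hS, hSu, h⟩
    have hlt : S.card < n := by
      simpa using Finset.card_lt_card (Finset.ssubset_univ_iff.2 hSu)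
    have hcard : Fintype.card {i // i ∈ S} = Fintype.card {i : Fin n // i.val < S.card} := by
      rw [Fintype.card_coe, Fintype.card_subtype, Fin.card_filter_val_lt, min_eq_right hlt.le]
    -- The permutation extends a bijection from `S` to the first `S.card` indices.
    let e := Fintype.equivOfCardEq hcard
    have hmem : ∀ x, x ∈ S ↔ (e.extendSubtype x).val < S.card := fun x =>
      ⟨fun hx => e.extendSubtype_mem x hx, fun hx => by
        by_contra hx'
        exact e.extendSubtype_not_mem x hx' hx⟩
    refine Or.inr ⟨hn, e.extendSubtype, S.card, hS.card_pos, by omega, fun i j hi hj => ?_⟩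
    rw [permMatrix_conj_apply]
    refine h _ ((hmem _).2 (by simpa using hi)) _ fun hj' => ?_
    have := (hmem _).1 hj'
    rw [Equiv.apply_symm_apply] at this
    omega

theorem IsIrreducible.inExpanding (hn : 2 ≤ n) (hP : IsNonneg P) (h : IsIrreducible P) :
    InExpanding 1 P := by
  intro F hF hFu
  by_contra! hno
  refine h ((isReducible_iff_exists_finset hn).2 ⟨Fᶜ, ?_, ?_, fun i hi j hj => ?_⟩)
  · rwa [Finset.nonempty_iff_ne_empty, Ne, Finset.compl_eq_empty_iff]
  · rwa [Finset.compl_ne_univ_iff_nonempty]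
  · obtain ⟨i', hi', hle⟩ := hno {i} (by simpa using hi) (by simp)
    rw [Finset.mem_singleton.1 hi'] at hle
    exact le_antisymm (hle j (by simpa using hj)) (hP i j)

theorem isIrreducible_of_isPos_pow {N : ℕ} (hN : 1 ≤ N) (hA : IsPos (P ^ N)) :
    IsIrreducible P := by
  intro h
  by_cases hn : 2 ≤ n
  · obtain ⟨S, ⟨i, hi⟩, hSu, hS⟩ := (isReducible_iff_exists_finset hn).1 h
    have key : ∀ t, ∀ i ∈ S, ∀ j ∉ S, (P ^ t) i j = 0 := by
      intro t
      induction t with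
      | zero =>
        intro i hi j hj
        rw [pow_zero, Matrix.one_apply_ne]
        rintro rfl
        exact hj hi
      | succ t ih =>
        intro i hi j hj
        rw [pow_succ, Matrix.mul_apply]
        refine Finset.sum_eq_zero fun u _ => ?_
        by_cases hu : u ∈ S
        · rw [hS u hu j hj, mul_zero]
        · rw [ih i hi u hu, zero_mul]
    obtain ⟨j, hj⟩ : ∃ j, j ∉ S := by
      by_contra! hall
      exact hSu (Finset.eq_univ_of_forall hall)
    exact (hA i j).ne' (key N i hi j hj)
  · rcases h with ⟨rfl, rfl⟩ | ⟨h2, -⟩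
    · have := hA 0 0
      rw [zero_pow (by omega)] at this
      exact lt_irrefl _ this
    · exact hn h2

theorem isPrimitive_of_isPos_pow (hn : 1 ≤ n) (hP : IsNonneg P) {N : ℕ} (hN : 1 ≤ N)
    (hA : IsPos (P ^ N)) : IsPrimitive P := by
  refine ⟨hP, isIrreducible_of_isPos_pow hN hA, ?_⟩
  obtain ⟨μ, hμ, hmax⟩ := exists_isEigenvalue_max hn P
  refine ⟨μ, ⟨hμ, hmax⟩, fun ν hν => ?_⟩
  rw [eq_norm_of_isPos_pow hP hN hA hμ hmax, eq_norm_of_isPos_pow hP hN hA hν.1 hν.2,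
    le_antisymm (hmax ν hν.1) (hν.2 μ hμ)]

/-! ### Primitive matrices have a positive power -/

/-- If all closed walks at `v` have length divisible by `d`, the spectrum is invariant under
rotation by a `d`-th root of unity. -/
theorem IsEigenvalue.mul_root_of_unity (hP : IsNonneg P)
    (hconn : ∀ i j, ∃ a, 0 < (P ^ a) i j) {v : Fin n} {d : ℕ}
    (hd : ∀ a, 0 < (P ^ a) v v → d ∣ a) {ω : ℂ} (hω0 : ω ≠ 0) (hω : ω ^ d = 1) {μ : ℂ}
    (hμ : IsEigenvalue P μ) : IsEigenvalue P (ω * μ) := by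
  obtain ⟨x, hx0, hx⟩ := isEigenvalue_iff_exists.1 hμ
  choose f hf using hconn v
  have hphase : ∀ i a, 0 < (P ^ a) v i → ω ^ a = ω ^ f i := fun i a ha => by
    obtain ⟨b, hb⟩ := hconn i v
    have hone : ∀ m, d ∣ m → ω ^ m = 1 := by
      rintro _ ⟨q, rfl⟩
      rw [pow_mul, hω, one_pow]
    have h1 := hone _ (hd _ (hP.pow_add_pos ha hb))
    have h2 := hone _ (hd _ (hP.pow_add_pos (hf i) hb))
    rw [pow_add] at h1 h2
    exact mul_right_cancel₀ (pow_ne_zero b hω0) (h1.trans h2.symm)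
  refine isEigenvalue_iff_exists.2 ⟨fun i => ω ^ f i * x i, fun h0 => hx0 ?_, fun i => ?_⟩
  · funext i
    exact (mul_eq_zero.1 (congrFun h0 i)).resolve_left (pow_ne_zero _ hω0)
  · have hterm : ∀ j, (P i j : ℂ) * (ω ^ f j * x j) = ω ^ (f i + 1) * ((P i j : ℂ) * x j) :=
      fun j => by
        rcases (hP i j).eq_or_lt with h0 | h0
        · rw [← h0]
          simp
        · rw [hphase j (f i + 1) (hP.pow_add_pos (hf i) (by simpa using h0))]
          ring
    simp only [hterm]
    rw [← Finset.mul_sum, hx]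
    ring

theorem IsPrimitive.exists_isPos_pow (hn : 2 ≤ n) (h : IsPrimitive P) : ∃ N, IsPos (P ^ N) := by
  obtain ⟨hP, hirr, μ, ⟨hμ, hmax⟩, huniq⟩ := h
  have hG := hirr.inExpanding hn hP
  have hrow := hG.exists_row_pos le_rfl hn
  have hconn : ∀ i j, ∃ a, a ≤ n ∧ 0 < (P ^ a) i j := fun i j =>
    hG.exists_pow_pos hP (by omega : n ≤ 1 + n * 1) i j
  -- The all-ones vector is stretched by at least the least row sum, which is positive.
  have hμ0 : μ ≠ 0 := by
    rintro rfl
    have hsum : ∀ i, 0 < ∑ j, P i j := fun i =>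
      (Finset.sum_pos_iff_of_nonneg fun j _ => hP i j).2 (by simpa using hrow i)
    obtain ⟨i₁, -, hi₁⟩ := Finset.exists_min_image Finset.univ (fun i => ∑ j, P i j)
      ⟨⟨0, by omega⟩, Finset.mem_univ _⟩
    obtain ⟨ν, hν, hge⟩ := hP.exists_isEigenvalue_ge (y := 1) (fun _ => zero_le_one)
      (fun h0 => one_ne_zero (congrFun h0 i₁)) (hsum i₁).le fun i => by
        simpa [Matrix.mulVec, dotProduct] using hi₁ i (Finset.mem_univ i)
    have h1 := hmax ν hν
    rw [norm_zero] at h1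
    exact absurd (hsum i₁) (by linarith)
  let v : Fin n := ⟨0, by omega⟩
  -- The lengths of closed walks at `v` form a monoid; once its gcd is `1`, it contains all large
  -- integers.
  let R : AddSubmonoid ℕ :=
    { carrier := {a | 0 < (P ^ a) v v}
      zero_mem' := (pow_zero_apply_pos_iff v v).2 rfl
      add_mem' := fun ha hb => hP.pow_add_pos ha hb }
  have hgcd : Nat.setGcd (R : Set ℕ) = 1 := by
    set d := Nat.setGcd (R : Set ℕ) with hd
    have hd0 : d ≠ 0 := fun h0 => by
      obtain ⟨r, hr, -, hr'⟩ := exists_closed_walk hP hG hrow (by omega : n ≤ 1 + n * 1) v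
      have := Nat.setGcd_eq_zero_iff.1 h0 (show r ∈ (R : Set ℕ) from hr')
      rw [Set.mem_singleton_iff] at this
      omega
    have hprim := Complex.isPrimitiveRoot_exp d hd0
    set ω := Complex.exp (2 * Real.pi * Complex.I / d) with hω
    have hdvd : ∀ a, 0 < (P ^ a) v v → d ∣ a := fun a ha =>
      Nat.setGcd_dvd_of_mem (show a ∈ (R : Set ℕ) from ha)
    have hωμ := hμ.mul_root_of_unity hP (fun i j => (hconn i j).imp fun _ => And.right) hdvd
      (hprim.ne_zero hd0) hprim.pow_eq_one
    have h1 := huniq (ω * μ) ⟨hωμ, fun ν hν => by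
      rw [norm_mul, hprim.norm'_eq_one hd0, one_mul]
      exact hmax ν hν⟩
    have h2 : ω = 1 := mul_right_cancel₀ hμ0 (h1.trans (one_mul μ).symm)
    exact Nat.dvd_one.1 ((hprim.pow_eq_one_iff_dvd 1).1 (by rw [pow_one, h2]))
  obtain ⟨K, hK⟩ := Nat.exists_mem_closure_of_ge (R : Set ℕ)
  have hret : ∀ m ≥ K, 0 < (P ^ m) v v := fun m hm => by
    have := hK m hm (hgcd ▸ one_dvd m)
    rwa [AddSubmonoid.closure_eq] at this
  refine ⟨K + n + n, fun i j => ?_⟩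
  obtain ⟨a, ha, hia⟩ := hconn i v
  obtain ⟨b, hb, hbj⟩ := hconn v j
  -- The closed walk at `v` absorbs the slack in `a` and `b`, giving all pairs the same total
  -- length.
  have := hP.pow_add_pos (hP.pow_add_pos hia (hret (K + (n - a) + (n - b)) (by omega))) hbj
  rwa [show a + (K + (n - a) + (n - b)) + b = K + n + n by omega] at this

theorem IsPrimitive.isPos_pow_one {P : Matrix (Fin 1) (Fin 1) ℝ} (h : IsPrimitive P) :
    IsPos (P ^ 1) := by
  obtain ⟨hP, hirr, -⟩ := h
  intro i j
  rw [pow_one]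
  refine (hP i j).lt_of_ne' fun h0 => hirr (Or.inl ⟨rfl, ?_⟩)
  ext a b
  rw [Subsingleton.elim a i, Subsingleton.elim b j]
  exact h0

theorem exponentH_pos {k : ℕ} (hn : 2 ≤ n) (hk : 1 ≤ k) (hkn : k ≤ n - 1) :
    1 ≤ exponentH n k := by
  rw [exponentH, if_neg (by omega)]
  split_ifs with h1
  · have : 2 * n ≤ n ^ 2 := by nlinarith
    rw [wielandtExponent]
    omega
  · have := exponentInt_pos n k (by omega) hkn
    omega

theorem IsPrimitive.isPos_pow_exponentH {k : ℕ} (hn : 2 ≤ n) (hk : 1 ≤ k) (hkn : k ≤ n - 1)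
    (hG : InExpanding k P) (h : IsPrimitive P) : IsPos (P ^ exponentH n k) := by
  obtain ⟨N, hN⟩ := h.exists_isPos_pow hn
  rw [exponentH, if_neg (by omega)]
  split_ifs with h1
  · exact isPos_pow_wielandtExponent hn h.1 (h1 ▸ hG) hN
  · exact isPos_pow_exponentInt (by omega) hkn h.1 hG hN

end GPlus

theorem theorem4p24 (n : ℕ) (hn : 1 ≤ n) (P : Matrix (Fin n) (Fin n) ℝ)
    (hP : GPlus.IsNonneg P) :
    (GPlus.IsPrimitive P ↔ GPlus.IsPos (P ^ GPlus.wielandtExponent n)) ∧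
    ∀ k : ℕ, GPlus.IsGPlusMatrix k P →
      (GPlus.IsPrimitive P ↔ GPlus.IsPos (P ^ GPlus.exponentH n k)) := by
  obtain rfl | hn2 : n = 1 ∨ 2 ≤ n := by omega
  · have key : GPlus.IsPrimitive P ↔ GPlus.IsPos (P ^ 1) :=
      ⟨fun h => h.isPos_pow_one, GPlus.isPrimitive_of_isPos_pow le_rfl hP le_rfl⟩
    exact ⟨key, fun k _ => key⟩
  · have key : ∀ k, 1 ≤ k → k ≤ n - 1 → (GPlus.IsPrimitive P → GPlus.InExpanding k P) →
        (GPlus.IsPrimitive P ↔ GPlus.IsPos (P ^ GPlus.exponentH n k)) := fun k hk hkn hG =>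
      ⟨fun h => h.isPos_pow_exponentH hn2 hk hkn (hG h),
        GPlus.isPrimitive_of_isPos_pow hn hP (GPlus.exponentH_pos hn2 hk hkn)⟩
    refine ⟨?_, fun k hk => ?_⟩
    · have := key 1 le_rfl (by omega) fun h => h.2.1.inExpanding hn2 hP
      rwa [GPlus.exponentH, if_neg (by omega), if_pos rfl] at this
    · obtain ⟨hk1, hkn, hG⟩ := hk.inExpanding hn2
      exact key k hk1 hkn fun _ => hG
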